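/- Let $N,n,r$ be natural numbers with $1\le r<N$, put $q=2^n$, and suppose $N^2\le q<2N^2$. Let $f:\mathbb Z\to\mathbb Z_N$ be periodic of period $r$: that is, $f(x)=f(x+r)$ for all $x\in\mathbb Z$, and $f(x)=f(x+y)$ implies $r\mid y$. Elements of $\mathbb Z_N$ are represented by the integers $0,\dots,N-1$. Consider two quantum registers, of $n$ qubits and of $L=\lceil\log_2 N\rceil$ qubits, with computational basis $|x\rangle|y\rangle$ ($0\le x<q$, $0\le y<2^L$), initially in the state $|0\rangle|0\rangle$. Apply the $n$-bit Walsh--Hadamard transformation to the first register and then the gate $U_f:|x\rangle|y\rangle\mapsto|x\rangle|y\oplus f(x)\rangle$ (bitwise exclusive or), which gives the state $\frac1{\sqrt q}\sum_{x=0}^{q-1}|x\rangle|f(x)\rangle$. Measure the second register in the computational basis, and let $b$ be the observed value (any value of positive probability). Apply to the first register of the resulting state the quantum Fourier transform $|x\rangle\mapsto\frac1{\sqrt q}\sum_{c=0}^{q-1}e^{-2\pi i cx/q}|c\rangle$, and then measure the first register in the computational basis. For an integer $s$ with $0\le s<r$ let $c_s$ be the unique integer with $-\frac r2\le c_sr-sq<\frac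 r2$. Let $P_b$ be the probability (given that $b$ was observed) that the value observed in the first register is equal to $c_s$ for some $s$ with $0\le s<r$, $\gcd(s,r)=1$ and $$\left|\frac{c_s}{q}-\frac sr\right|<\frac1{2r^2}.$$ Then $$P_b\ \ge\ \frac{4\varphi(r)}{\pi^2r^2}\left(1-\left(\frac{\pi r}{2q}\right)^2\right),$$ where $\varphi$ is Euler's totient function. Moreover, if $N\ge158$ and $r\ge19$, then $$P_b\ \ge\ \frac1{10\,\log_e\log_e N}.$$ -/

import Mathlib

open scoped Kronecker

/-- A function `f : ℤ → S` is periodic with period `r`: `f x = f (x + r)` for all `x`, and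
`f x = f (x + y)` only if `r ∣ y`. -/
def HasPeriod {S : Type*} (f : ℤ → S) (r : ℤ) : Prop :=
  (∀ x : ℤ, f x = f (x + r)) ∧ ∀ x y : ℤ, f x = f (x + y) → r ∣ y

noncomputable section

/-- The state space of two quantum registers, of `n` and `L` qubits. The basis vector
`|x⟩|y⟩` is labelled by the pair of binary integers `x < 2 ^ n`, `y < 2 ^ L`. -/
abbrev TwoRegisters (n L : ℕ) : Type :=
  EuclideanSpace ℂ (Fin (2 ^ n) × Fin (2 ^ L))

/-- The basis vector `|x⟩|y⟩`. -/
def ket {n L : ℕ} (x : Fin (2 ^ n)) (y : Fin (2 ^ L)) : TwoRegisters n L :=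
  EuclideanSpace.single (x, y) 1

/-- The action of a matrix (in the computational basis) on a state. -/
def applyMatrix {n L : ℕ}
    (M : Matrix (Fin (2 ^ n) × Fin (2 ^ L)) (Fin (2 ^ n) × Fin (2 ^ L)) ℂ)
    (v : TwoRegisters n L) : TwoRegisters n L :=
  Matrix.toEuclideanLin M v

/-- The single qubit Walsh-Hadamard transformation
`|a⟩ ↦ (|0⟩ + (-1) ^ a |1⟩) / √2`; the bits `0`, `1` are `false`, `true`. -/
def hadamard : Matrix Bool Bool ℂ :=
  Matrix.of fun a b => ((1 / √2 : ℝ) : ℂ) * (if a && b then -1 else 1)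

/-- The `n`-bit Walsh-Hadamard transformation, the `n`-th tensor power of `hadamard`; the
tensor factors are the binary digits of the basis labels. -/
def walshHadamard (n : ℕ) : Matrix (Fin (2 ^ n)) (Fin (2 ^ n)) ℂ :=
  Matrix.of fun x' x =>
    ∏ j : Fin n, hadamard ((x' : ℕ).testBit j) ((x : ℕ).testBit j)

/-- The evaluation gate `U_f : |x⟩|y⟩ ↦ |x⟩|f(x) ⊕ y⟩`, where `⊕` is bitwise addition modulo `2`
and an element of `ℤ/N` is written as a binary integer in `[0, N)`. -/
def evalGate {N : ℕ} (f : ℤ → ZMod N) (n L : ℕ) :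
    Matrix (Fin (2 ^ n) × Fin (2 ^ L)) (Fin (2 ^ n) × Fin (2 ^ L)) ℂ :=
  Matrix.of fun u v =>
    if u.1 = v.1 ∧ (u.2 : ℕ) = (f ((v.1 : ℕ) : ℤ)).val ^^^ (v.2 : ℕ) then 1 else 0

/-- The quantum Fourier transform on `ℤ/q`: `|x⟩ ↦ q ^ (-1/2) ∑_c exp (-2πicx/q) |c⟩`. -/
def qftMatrix (q : ℕ) : Matrix (Fin q) (Fin q) ℂ :=
  Matrix.of fun c x =>
    ((1 / √(q : ℝ) : ℝ) : ℂ) *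
      Complex.exp (-(2 * Real.pi * Complex.I * (c : ℕ) * (x : ℕ) / q))

/-- `|c⟩⟨c| ⊗ I`: the operator for the outcome `c` when the first register is measured in the
computational basis. -/
def measureFirst {n : ℕ} (L : ℕ) (c : Fin (2 ^ n)) :
    Matrix (Fin (2 ^ n) × Fin (2 ^ L)) (Fin (2 ^ n) × Fin (2 ^ L)) ℂ :=
  Matrix.single c c (1 : ℂ) ⊗ₖ (1 : Matrix (Fin (2 ^ L)) (Fin (2 ^ L)) ℂ)

/-- `I ⊗ |b⟩⟨b|`: the operator for the outcome `b` when the second register is measured in the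
computational basis. -/
def measureSecond (n : ℕ) {L : ℕ} (b : Fin (2 ^ L)) :
    Matrix (Fin (2 ^ n) × Fin (2 ^ L)) (Fin (2 ^ n) × Fin (2 ^ L)) ℂ :=
  (1 : Matrix (Fin (2 ^ n)) (Fin (2 ^ n)) ℂ) ⊗ₖ Matrix.single b b (1 : ℂ)

/-- The probability `⟨M v | M v⟩` of the outcome with measurement operator `M` in the state `v`. -/
def outcomeProb {n L : ℕ}
    (M : Matrix (Fin (2 ^ n) × Fin (2 ^ L)) (Fin (2 ^ n) × Fin (2 ^ L)) ℂ)
    (v : TwoRegisters n L) : ℝ :=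
  ‖applyMatrix M v‖ ^ 2

/-- The state `M v / √p` after the outcome with measurement operator `M`, of probability `p`. -/
def postState {n L : ℕ}
    (M : Matrix (Fin (2 ^ n) × Fin (2 ^ L)) (Fin (2 ^ n) × Fin (2 ^ L)) ℂ)
    (v : TwoRegisters n L) : TwoRegisters n L :=
  ((1 / √(outcomeProb M v) : ℝ) : ℂ) • applyMatrix M v

/-- The number of qubits of the second register, `L = ⌈log₂ N⌉`. -/
def secondSize (N : ℕ) : ℕ := Nat.clog 2 N

/-- The state of the two registers after `W_n ⊗ I` and then `U_f` are applied to `|0⟩|0⟩`. -/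
def preparedState {N : ℕ} (f : ℤ → ZMod N) (n : ℕ) : TwoRegisters n (secondSize N) :=
  applyMatrix (evalGate f n (secondSize N))
    (applyMatrix
      (walshHadamard n ⊗ₖ (1 : Matrix (Fin (2 ^ secondSize N)) (Fin (2 ^ secondSize N)) ℂ))
      (ket 0 0))

/-- The probability that the second register of `preparedState f n` is observed to be `b`. -/
def secondProb {N : ℕ} (f : ℤ → ZMod N) (n : ℕ) (b : Fin (2 ^ secondSize N)) : ℝ :=
  outcomeProb (measureSecond n b) (preparedState f n)

/-- The state after the second register is observed to be `b` and then the quantum Fourier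
transform on `ℤ/2^n` is applied to the first register. -/
def transformedState {N : ℕ} (f : ℤ → ZMod N) (n : ℕ) (b : Fin (2 ^ secondSize N)) :
    TwoRegisters n (secondSize N) :=
  applyMatrix
    (qftMatrix (2 ^ n) ⊗ₖ (1 : Matrix (Fin (2 ^ secondSize N)) (Fin (2 ^ secondSize N)) ℂ))
    (postState (measureSecond n b) (preparedState f n))

/-- `c` is the integer `c_s` nearest to `s q / r`, in the sense `-r/2 ≤ c r - s q < r/2`. -/
def IsNearestTo (q r s c : ℕ) : Prop :=
  -(r : ℝ) / 2 ≤ (c : ℝ) * r - (s : ℝ) * q ∧ (c : ℝ) * r - (s : ℝ) * q < (r : ℝ) / 2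

/-- The observed value `c` is good: it is `c_s` for some `0 ≤ s < r` which is coprime to `r`,
and `|c / q - s / r| < 1 / (2 r ^ 2)`. -/
def IsGood (q r c : ℕ) : Prop :=
  ∃ s : ℕ, s < r ∧ Nat.gcd s r = 1 ∧ IsNearestTo q r s c ∧
    |(c : ℝ) / q - (s : ℝ) / r| < 1 / (2 * (r : ℝ) ^ 2)

open Classical in
/-- The probability that measuring the first register of `transformedState f n b` gives a good
value. -/
def goodProb {N : ℕ} (f : ℤ → ZMod N) (n r : ℕ) (b : Fin (2 ^ secondSize N)) : ℝ :=
  ∑ c ∈ (Finset.univ : Finset (Fin (2 ^ n))).filter (fun c : Fin (2 ^ n) => IsGood (2 ^ n) r c),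
    outcomeProb (measureFirst (secondSize N) c) (transformedState f n b)

end

/-! Observing `b` leaves the first register in a uniform superposition over a progression `x₀ + j
r`, `j < m`, with `(m - 1) r < q < (m + 1) r`. Outcome `c` then has probability `|S|² / (q m)`,
where `S` is a geometric sum whose ratio depends on `c r` only modulo `q`. If `|c r - s q| ≤ r / 2`,
Jordan's inequality for the sine, extended slightly beyond `π / 2`, bounds `S` below
(`le_norm_sum_exp_pow`). The `φ(r)` residues coprime to `r` give distinct good outcomes, so with `η
= r / q` the total is at least `4 / π² · φ(r) / r · (1 - η)³ / (1 + η)²`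
(`totient_mul_le_goodProb_of_hasPeriod`).

The first claim has `r²` in its denominator, so it suffices that the factor in `η` is at least `1 /
r`; only `r = 1` and `r = 2` need separate care. The second claim needs `r / φ(r) ≤ 3.92 log log N`
(`div_totient_le_mul_log_log`). For moderate `r` this comes from comparing the prime factors of `r`
with explicit lists. For `log r ≥ 10000`, comparing the product of `p / (p - 1)` over `p ∣ r` with
the Euler product of `ζ(1 + ε)`, together with Mertens' first theorem, gives `e (log log r + 4)`. -/

/-! ### Bounds for `r / φ(r)` from finite lists. -/

/-- Common factors cancel, and `c` separates the remaining ones; as `1 ≤ c`, the surplus elements of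
`B` can only help. -/
theorem Finset.prod_le_prod_of_card_le {ι : Type*} [DecidableEq ι] {A B : Finset ι} {f : ι → ℝ}
    {c : ℝ} (hc : 1 ≤ c) (hA : ∀ i ∈ A, 0 < f i) (hAc : ∀ i ∈ A \ B, f i ≤ c)
    (hBc : ∀ i ∈ B \ A, c ≤ f i) (h : A.card ≤ B.card) : ∏ i ∈ A, f i ≤ ∏ i ∈ B, f i := by
  rw [← Finset.prod_inter_mul_prod_sdiff A B, ← Finset.prod_inter_mul_prod_sdiff B A,
    Finset.inter_comm B A]
  have h0 : 0 ≤ ∏ i ∈ A ∩ B, f i :=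
    Finset.prod_nonneg fun i hi => (hA i (Finset.mem_inter.1 hi).1).le
  refine mul_le_mul_of_nonneg_left ?_ h0
  have hcard : (A \ B).card ≤ (B \ A).card := by
    have h1 := Finset.card_sdiff_add_card_inter A B
    have h2 := Finset.card_sdiff_add_card_inter B A
    rw [Finset.inter_comm] at h2
    omega
  calc ∏ i ∈ A \ B, f i ≤ ∏ i ∈ A \ B, c :=
        Finset.prod_le_prod (fun i hi => (hA i (Finset.mem_sdiff.1 hi).1).le) hAc
    _ = c ^ (A \ B).card := by simp
    _ ≤ c ^ (B \ A).card := pow_le_pow_right₀ hc hcard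
    _ = ∏ i ∈ B \ A, c := by simp
    _ ≤ ∏ i ∈ B \ A, f i := Finset.prod_le_prod (fun i _ => by linarith) hBc

/-- The numbers `2 ≤ n ≤ y` that are members of `l` or coprime to the product of `l`. -/
def roughList (l : List ℕ) (y : ℕ) : List ℕ :=
  (List.range' 2 (y - 1)).filter fun n => l.contains n || Nat.gcd n l.prod == 1

theorem roughList_nodup (l : List ℕ) (y : ℕ) : (roughList l y).Nodup :=
  (List.nodup_range' ..).filter _

theorem le_of_mem_roughList {l : List ℕ} {y n : ℕ} (h : n ∈ roughList l y) : 2 ≤ n ∧ n ≤ y := by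
  simp only [roughList, List.mem_filter, List.mem_range'_1] at h
  omega

theorem Nat.Prime.mem_roughList {l : List ℕ} {y p : ℕ} (hp : p.Prime) (hl : ∀ a ∈ l, a.Prime)
    (hy : p ≤ y) : p ∈ roughList l y := by
  have h2 := hp.two_le
  simp only [roughList, List.mem_filter, List.mem_range'_1, List.contains_eq_mem,
    Bool.or_eq_true, decide_eq_true_eq, beq_iff_eq]
  refine ⟨by omega, ?_⟩
  by_cases h : p ∣ l.prod
  · left
    obtain ⟨a, ha, hpa⟩ := (hp.prime.dvd_prod_iff).1 h
    rwa [(Nat.prime_dvd_prime_iff_eq hp (hl a ha)).1 hpa]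
  · right
    exact (hp.coprime_iff_not_dvd).2 h

/-- The list contains every prime up to `y`, so a prime of `S` outside it exceeds `y`, and `1 + 1 /
y` separates the factors. Composites in the list do no harm, so primality of its members is never
tested. -/
theorem prod_div_pred_le_of_card_le {l : List ℕ} {y : ℕ} (hy : 1 ≤ y) (hl : ∀ a ∈ l, a.Prime)
    {S : Finset ℕ} (hS : ∀ p ∈ S, p.Prime) (h : S.card ≤ (roughList l y).length) :
    ∏ p ∈ S, (p : ℝ) / ((p - 1 : ℕ) : ℝ) ≤
      ((roughList l y).prod : ℝ) / ((((roughList l y).map (· - 1)).prod : ℕ) : ℝ) := by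
  have key : ∏ p ∈ S, (p : ℝ) / ((p - 1 : ℕ) : ℝ) ≤
      ∏ p ∈ (roughList l y).toFinset, (p : ℝ) / ((p - 1 : ℕ) : ℝ) := by
    have hy' : (1 : ℝ) ≤ y := by exact_mod_cast hy
    refine Finset.prod_le_prod_of_card_le (c := 1 + 1 / (y : ℝ)) ?_ ?_ ?_ ?_ ?_
    · have : 0 ≤ 1 / (y : ℝ) := by positivity
      linarith
    · intro p hp
      have := (hS p hp).two_le
      have h1 : 0 < p - 1 := by omega
      positivity
    · intro p hp
      obtain ⟨hp1, hp2⟩ := Finset.mem_sdiff.1 hp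
      have hyp : y < p := by
        by_contra hc
        exact hp2 (List.mem_toFinset.2 ((hS p hp1).mem_roughList hl (not_lt.1 hc)))
      have hyp' : (y : ℝ) + 1 ≤ p := by exact_mod_cast hyp
      rw [Nat.cast_sub (by omega), Nat.cast_one]
      have : (p : ℝ) / (p - 1) = 1 + 1 / (p - 1) := by
        have : (p : ℝ) - 1 ≠ 0 := by linarith
        field_simp
        ring
      rw [this]
      gcongr
      linarith
    · intro p hp
      obtain ⟨hp1, -⟩ := Finset.mem_sdiff.1 hp
      obtain ⟨h2, hpy⟩ := le_of_mem_roughList (List.mem_toFinset.1 hp1)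
      have h2' : (2 : ℝ) ≤ p := by exact_mod_cast h2
      have hpy' : (p : ℝ) ≤ y := by exact_mod_cast hpy
      rw [Nat.cast_sub (by omega), Nat.cast_one]
      have : (p : ℝ) / (p - 1) = 1 + 1 / (p - 1) := by
        have : (p : ℝ) - 1 ≠ 0 := by linarith
        field_simp
        ring
      rw [this]
      gcongr
      · linarith
      · linarith
    · rwa [List.toFinset_card_of_nodup (roughList_nodup l y)]
  refine key.trans_eq ?_
  rw [Finset.prod_div_distrib, List.prod_toFinset _ (roughList_nodup l y),
    List.prod_toFinset _ (roughList_nodup l y), Nat.cast_list_prod, Nat.cast_list_prod,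
    List.map_map]
  rfl

theorem prod_roughList_le {l : List ℕ} {y : ℕ} (hy : 1 ≤ y) (hl : ∀ a ∈ l, a.Prime)
    {S : Finset ℕ} (hS : ∀ p ∈ S, p.Prime) (h : (roughList l y).length ≤ S.card) :
    (roughList l y).prod ≤ ∏ p ∈ S, p := by
  have key : ∏ p ∈ (roughList l y).toFinset, (p : ℝ) ≤ ∏ p ∈ S, (p : ℝ) := by
    refine Finset.prod_le_prod_of_card_le (c := y) (by exact_mod_cast hy) ?_ ?_ ?_ ?_
    · intro p hp
      have := (le_of_mem_roughList (List.mem_toFinset.1 hp)).1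
      positivity
    · intro p hp
      exact_mod_cast (le_of_mem_roughList (List.mem_toFinset.1 (Finset.mem_sdiff.1 hp).1)).2
    · intro p hp
      obtain ⟨hp1, hp2⟩ := Finset.mem_sdiff.1 hp
      by_contra hc
      have hc' : p < y := by exact_mod_cast not_le.1 hc
      exact hp2 (List.mem_toFinset.2 ((hS p hp1).mem_roughList hl hc'.le))
    · rwa [List.toFinset_card_of_nodup (roughList_nodup l y)]
  have h2 : (∏ p ∈ (roughList l y).toFinset, p) = (roughList l y).prod := by
    rw [List.prod_toFinset _ (roughList_nodup l y), List.map_id']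
  rw [← h2]
  rw [← Nat.cast_prod, ← Nat.cast_prod] at key
  exact_mod_cast key

theorem totient_inv_eq_prod {r : ℕ} (hr : r ≠ 0) :
    (r : ℝ) / (r.totient : ℝ) = ∏ p ∈ r.primeFactors, (p : ℝ) / ((p - 1 : ℕ) : ℝ) := by
  have h := Nat.totient_mul_prod_primeFactors r
  have h' : (r.totient : ℝ) * ∏ p ∈ r.primeFactors, (p : ℝ) =
      r * ∏ p ∈ r.primeFactors, ((p - 1 : ℕ) : ℝ) := by
    rw [← Nat.cast_prod, ← Nat.cast_prod, ← Nat.cast_mul, ← Nat.cast_mul, h]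
  rw [Finset.prod_div_distrib, div_eq_div_iff, mul_comm _ (r.totient : ℝ), h']
  · exact_mod_cast (Nat.totient_pos.2 (Nat.pos_of_ne_zero hr)).ne'
  · refine Finset.prod_ne_zero_iff.2 fun p hp => ?_
    have := (Nat.prime_of_mem_primeFactors hp).two_le
    exact_mod_cast (by omega : p - 1 ≠ 0)

/-- Either `r / φ(r)` is bounded by a product over the list, or `r` is large. -/
theorem div_totient_le_or_le {l : List ℕ} {y a b M : ℕ} (hy : 1 ≤ y) (hb : 0 < b)
    (hl : ∀ a ∈ l, a.Prime)
    (h : b * (roughList l y).prod ≤ a * ((roughList l y).map (· - 1)).prod ∧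
      M ≤ (roughList l y).prod) {r : ℕ} (hr : r ≠ 0) :
    (r : ℝ) / (r.totient : ℝ) ≤ a / b ∨ M ≤ r := by
  rcases le_total r.primeFactors.card (roughList l y).length with hc | hc
  · left
    rw [totient_inv_eq_prod hr]
    refine (prod_div_pred_le_of_card_le hy hl (fun p hp => Nat.prime_of_mem_primeFactors hp)
      hc).trans ?_
    have hpos : 0 < ((roughList l y).map (· - 1)).prod := by
      refine List.prod_pos fun n hn => ?_
      obtain ⟨k, hk, rfl⟩ := List.mem_map.1 hn
      have := (le_of_mem_roughList hk).1
      omega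
    rw [div_le_div_iff₀ (by exact_mod_cast hpos) (by exact_mod_cast hb), mul_comm]
    exact_mod_cast h.1
  · right
    refine h.2.trans ((prod_roughList_le hy hl
      (fun p hp => Nat.prime_of_mem_primeFactors hp) hc).trans ?_)
    exact Nat.le_of_dvd (Nat.pos_of_ne_zero hr) (Nat.prod_primeFactors_dvd r)

theorem div_totient_le_or_three_pow_seventeen_le {r : ℕ} (hr : r ≠ 0) :
    (r : ℝ) / (r.totient : ℝ) ≤ 612 / 100 ∨ 3 ^ 17 ≤ r := by
  have := div_totient_le_or_le (l := [2, 3, 5, 7, 11, 13, 17, 19, 23]) (y := 28) (a := 612)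
    (b := 100) (M := 3 ^ 17) (by norm_num) (by norm_num) (by norm_num) (by decide +kernel) hr
  exact_mod_cast this

/-- Sieving by a few primes keeps the kernel computation short; surviving composites such as `17²`
cost little. Thresholds are powers of `3` because `3 > e` turns them at once into bounds for `log
r`. -/
theorem div_totient_le_or_three_pow_le {r : ℕ} (hr : r ≠ 0) :
    (r : ℝ) / (r.totient : ℝ) ≤ 1088 / 100 ∨ 3 ^ 358 ≤ r := by
  have := div_totient_le_or_le (l := [2, 3, 5, 7, 11, 13]) (y := 400) (a := 1088)
    (b := 100) (M := 3 ^ 358) (by norm_num) (by norm_num) (by norm_num) (by decide +kernel) hr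
  exact_mod_cast this

theorem div_totient_le_or_three_pow_large_le {r : ℕ} (hr : r ≠ 0) :
    (r : ℝ) / (r.totient : ℝ) ≤ 22 ∨ 3 ^ 10500 ≤ r := by
  have := div_totient_le_or_le (l := [2, 3, 5, 7]) (y := 6500) (a := 22)
    (b := 1) (M := 3 ^ 10500) (by norm_num) (by norm_num) (by norm_num) (by decide +kernel) hr
  rcases this with h | h
  · left; simpa using h
  · right; exact h

/-! ### Large `r`: the Euler product near `1` and Mertens' theorem. -/

theorem Real.inv_succ_le_log_sub_log {m : ℕ} (hm : 1 ≤ m) :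
    1 / ((m : ℝ) + 1) ≤ Real.log ((m : ℝ) + 1) - Real.log m := by
  have hm' : (1 : ℝ) ≤ m := by exact_mod_cast hm
  rw [← Real.log_div (by positivity) (by positivity)]
  refine le_trans (le_of_eq ?_) (Real.one_sub_inv_le_log_of_pos (by positivity))
  field_simp
  ring

/-- The integral test for `ζ(1 + ε)`, in telescoped form. The term `n = 0` vanishes by the
convention for `0` to a nonzero real power. -/
theorem sum_rpow_neg_le {ε : ℝ} (hε : 0 < ε) {m : ℕ} (hm : 1 ≤ m) :
    ∑ n ∈ Finset.range (m + 1), (n : ℝ) ^ (-(1 + ε)) ≤ 1 + 1 / ε * (1 - (m : ℝ) ^ (-ε)) := by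
  induction m, hm using Nat.le_induction with
  | base =>
    have : (0 : ℝ) ^ (-(1 + ε)) = 0 := Real.zero_rpow (by linarith)
    rw [Finset.sum_range_succ, Finset.sum_range_one, Nat.cast_zero, this]
    simp
  | succ m hm ih =>
    rw [Finset.sum_range_succ]
    have hm' : (1 : ℝ) ≤ m := by exact_mod_cast hm
    have key : ((m : ℝ) + 1) ^ (-(1 + ε)) ≤
        1 / ε * ((m : ℝ) ^ (-ε) - ((m : ℝ) + 1) ^ (-ε)) := by
      have h1 : (m : ℝ) ^ (-ε) =
          ((m : ℝ) + 1) ^ (-ε) * Real.exp (ε * (Real.log (m + 1) - Real.log m)) := by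
        rw [Real.rpow_def_of_pos (by positivity), Real.rpow_def_of_pos (by positivity),
          ← Real.exp_add]
        congr 1
        ring
      have h2 : ((m : ℝ) + 1) ^ (-(1 + ε)) = ((m : ℝ) + 1) ^ (-ε) * (1 / (m + 1)) := by
        rw [neg_add_rev, Real.rpow_add (by positivity), Real.rpow_neg_one, one_div]
      have h3 : 1 + ε * (1 / ((m : ℝ) + 1)) ≤
          Real.exp (ε * (Real.log (m + 1) - Real.log m)) := by
        have := Real.add_one_le_exp (ε * (Real.log (m + 1) - Real.log m))
        have h4 := mul_le_mul_of_nonneg_left (Real.inv_succ_le_log_sub_log hm) hε.le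
        linarith
      have h5 : 0 < ((m : ℝ) + 1) ^ (-ε) := Real.rpow_pos_of_pos (by positivity) _
      rw [h1, h2, one_div ε, le_inv_mul_iff₀ hε]
      nlinarith
    push_cast
    have : 1 / ε * (1 - ((m : ℝ) + 1) ^ (-ε)) = 1 / ε * (1 - (m : ℝ) ^ (-ε)) +
        1 / ε * ((m : ℝ) ^ (-ε) - ((m : ℝ) + 1) ^ (-ε)) := by ring
    linarith

/-- The completely multiplicative function `n ↦ n ^ (-s)`. -/
noncomputable def rpowNegHom (s : ℝ) : ℕ →* ℝ where
  toFun n := (n : ℝ) ^ (-s)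
  map_one' := by simp
  map_mul' a b := by
    push_cast
    exact Real.mul_rpow (by positivity) (by positivity)

theorem prod_one_sub_rpow_inv_le {ε : ℝ} (hε : 0 < ε) {S : Finset ℕ} (hS : ∀ p ∈ S, p.Prime) :
    ∏ p ∈ S, (1 - (p : ℝ) ^ (-(1 + ε)))⁻¹ ≤ 1 + 1 / ε := by
  have hsum : Summable (rpowNegHom (1 + ε)) := by
    have := (Real.summable_nat_rpow (p := -(1 + ε))).2 (by linarith)
    exact this
  have h := EulerProduct.prod_filter_prime_geometric_eq_tsum_factoredNumbers hsum S
  rw [Finset.filter_true_of_mem hS] at h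
  have h0 : ∀ n, 0 ≤ rpowNegHom (1 + ε) n := fun n =>
    Real.rpow_nonneg (Nat.cast_nonneg n) _
  calc _ = ∑' m : Nat.factoredNumbers S, rpowNegHom (1 + ε) m := h
    _ ≤ ∑' n, rpowNegHom (1 + ε) n := hsum.tsum_subtype_le _ _ h0
    _ ≤ 1 + 1 / ε := by
      refine hsum.tsum_le_of_sum_range_le fun n => ?_
      have h1 : ∑ i ∈ Finset.range n, rpowNegHom (1 + ε) i ≤
          ∑ i ∈ Finset.range (n + 1 + 1), rpowNegHom (1 + ε) i :=
        Finset.sum_le_sum_of_subset_of_nonneg (Finset.range_mono (by omega)) fun i _ _ => h0 i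
      refine h1.trans ((sum_rpow_neg_le hε (Nat.le_add_left 1 n)).trans ?_)
      have : 0 < ((n + 1 : ℕ) : ℝ) ^ (-ε) := Real.rpow_pos_of_pos (by positivity) _
      have : 0 < 1 / ε := by positivity
      nlinarith

/-- The ratio of the two Euler factors is `1 + (1 - p ^ (-ε)) / (p - 1)`, and `1 - p ^ (-ε) ≤ ε log
p`. -/
theorem div_pred_le_mul_exp {ε : ℝ} (hε : 0 < ε) {p : ℕ} (hp : 2 ≤ p) :
    (p : ℝ) / ((p - 1 : ℕ) : ℝ) ≤
      (1 - (p : ℝ) ^ (-(1 + ε)))⁻¹ * Real.exp (ε * (Real.log p / (p - 1))) := by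
  have hp' : (2 : ℝ) ≤ p := by exact_mod_cast hp
  rw [Nat.cast_sub (by omega), Nat.cast_one]
  have hp1 : (0 : ℝ) < p - 1 := by linarith
  have h2 : (p : ℝ) ^ (-(1 + ε)) = (p : ℝ) ^ (-ε) * (1 / p) := by
    rw [neg_add_rev, Real.rpow_add (by positivity), Real.rpow_neg_one, one_div]
  have h3 : 1 - ε * Real.log p ≤ (p : ℝ) ^ (-ε) := by
    rw [Real.rpow_def_of_pos (by positivity)]
    have := Real.add_one_le_exp (Real.log p * -ε)
    linarith
  have h4 : (p : ℝ) ^ (-ε) ≤ 1 := Real.rpow_le_one_of_one_le_of_nonpos (by linarith) (by linarith)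
  have h5 : 0 < (p : ℝ) ^ (-ε) := Real.rpow_pos_of_pos (by positivity) _
  have h6 : 0 < 1 - (p : ℝ) ^ (-(1 + ε)) := by
    rw [h2]
    have : 1 / (p : ℝ) < 1 := by rw [div_lt_one (by positivity)]; linarith
    have : 0 < 1 / (p : ℝ) := by positivity
    nlinarith
  rw [inv_mul_eq_div, le_div_iff₀ h6]
  refine le_trans ?_ (Real.add_one_le_exp _)
  rw [h2]
  have : (p : ℝ) / (p - 1) * (1 - (p : ℝ) ^ (-ε) * (1 / p)) = 1 + (1 - (p : ℝ) ^ (-ε)) / (p - 1) := by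
    field_simp
    ring
  rw [this, ← mul_div_assoc, add_comm]
  gcongr
  linarith

theorem prod_div_pred_le {ε : ℝ} (hε : 0 < ε) {S : Finset ℕ} (hS : ∀ p ∈ S, p.Prime) :
    ∏ p ∈ S, (p : ℝ) / ((p - 1 : ℕ) : ℝ) ≤
      (1 + 1 / ε) * Real.exp (ε * ∑ p ∈ S, Real.log p / ((p : ℝ) - 1)) := by
  calc _ ≤ ∏ p ∈ S, ((1 - (p : ℝ) ^ (-(1 + ε)))⁻¹ * Real.exp (ε * (Real.log p / (p - 1)))) :=
        Finset.prod_le_prod (fun p _ => by positivity)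
          fun p hp => div_pred_le_mul_exp hε (hS p hp).two_le
    _ = (∏ p ∈ S, (1 - (p : ℝ) ^ (-(1 + ε)))⁻¹) *
        Real.exp (ε * ∑ p ∈ S, Real.log p / ((p : ℝ) - 1)) := by
        rw [Finset.prod_mul_distrib, ← Real.exp_sum, Finset.mul_sum]
    _ ≤ _ := by
        gcongr
        exact prod_one_sub_rpow_inv_le hε hS

theorem log_factorial_le {n : ℕ} (hn : 1 ≤ n) :
    Real.log (n.factorial : ℝ) ≤ n * Real.log n - n + 1 + Real.log n := by
  induction n, hn using Nat.le_induction with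
  | base => simp
  | succ n hn ih =>
    have h := Real.inv_succ_le_log_sub_log hn
    rw [Nat.factorial_succ]
    push_cast
    rw [Real.log_mul (by positivity) (by positivity)]
    rw [div_le_iff₀ (by positivity)] at h
    nlinarith

/-- An upper bound in Mertens' first theorem. -/
theorem sum_log_div_le {n : ℕ} (hn : 1 ≤ n) :
    ∑ p ∈ n.primesLE, Real.log p / p ≤
      Real.log n - 1 + Real.log 4 + (1 + Real.log n) / n := by
  have hn' : (1 : ℝ) ≤ n := by exact_mod_cast hn
  -- Legendre: `p` divides `n!` at least `⌊n / p⌋ > n / p - 1` times. The resulting loss is `θ(n) ≤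
  -- n log 4`.
  have h1 : ∑ p ∈ n.primesLE, ((n : ℝ) / p - 1) * Real.log p ≤ Real.log (n.factorial : ℝ) := by
    rw [Real.log_nat_eq_sum_factorization, Finsupp.sum, Nat.support_factorization]
    have hsub : n.primesLE ⊆ n.factorial.primeFactors := by
      intro p hp
      have hpp := Nat.prime_of_mem_primesLE hp
      exact Nat.mem_primeFactors.2 ⟨hpp, hpp.dvd_factorial.2 (Nat.le_of_mem_primesLE hp),
        Nat.factorial_ne_zero n⟩
    refine le_trans (Finset.sum_le_sum fun p hp => ?_)
      (Finset.sum_le_sum_of_subset_of_nonneg hsub fun p _ _ =>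
        mul_nonneg (Nat.cast_nonneg _) (Real.log_natCast_nonneg p))
    refine mul_le_mul_of_nonneg_right ?_ (Real.log_natCast_nonneg p)
    have hpp := Nat.prime_of_mem_primesLE hp
    have h2 : n / p ≤ n.factorial.factorization p := by
      rw [Nat.factorization_factorial hpp (b := Nat.log p n + 2) (by omega)]
      have := Finset.single_le_sum (f := fun i => n / p ^ i) (fun i _ => Nat.zero_le _)
        (Finset.mem_Ico.2 ⟨le_refl 1, (by omega : 1 < Nat.log p n + 2)⟩)
      simpa using this
    have h3 : (n : ℝ) / p < ((n / p : ℕ) : ℝ) + 1 := by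
      rw [← Nat.floor_div_eq_div (K := ℝ)]
      exact Nat.lt_floor_add_one _
    have h4 : ((n / p : ℕ) : ℝ) ≤ (n.factorial.factorization p : ℝ) := by exact_mod_cast h2
    linarith
  have h2 : ∑ p ∈ n.primesLE, ((n : ℝ) / p - 1) * Real.log p =
      n * ∑ p ∈ n.primesLE, Real.log p / p - ∑ p ∈ n.primesLE, Real.log p := by
    rw [Finset.mul_sum, ← Finset.sum_sub_distrib]
    refine Finset.sum_congr rfl fun p _ => by ring
  have h3 : ∑ p ∈ n.primesLE, Real.log p ≤ Real.log 4 * n := by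
    rw [← Chebyshev.theta_eq_sum_primesLE_log]
    exact Chebyshev.theta_le_log4_mul_x (Nat.cast_nonneg n)
  have h4 := log_factorial_le hn
  have h5 : (n : ℝ) * ∑ p ∈ n.primesLE, Real.log p / p ≤
      n * (Real.log n - 1 + Real.log 4 + (1 + Real.log n) / n) := by
    have : (n : ℝ) * (Real.log n - 1 + Real.log 4 + (1 + Real.log n) / n) =
        n * Real.log n - n + n * Real.log 4 + (1 + Real.log n) := by
      field_simp
    linarith
  exact le_of_mul_le_mul_left h5 (by linarith)

theorem sum_log_div_mul_pred_le (m : ℕ) :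
    ∑ n ∈ Finset.Icc 2 (m + 1), Real.log n / ((n : ℝ) * (n - 1)) ≤
      3 / 2 - (Real.log ((m : ℝ) + 1) + 3 / 2) / (m + 1) := by
  induction m with
  | zero => simp
  | succ m ih =>
    rw [Finset.sum_Icc_succ_top (by omega)]
    have key : Real.log ((m : ℝ) + 2) / (((m : ℝ) + 2) * (m + 1)) ≤
        (Real.log ((m : ℝ) + 1) + 3 / 2) / (m + 1) -
          (Real.log ((m : ℝ) + 2) + 3 / 2) / (m + 2) := by
      -- This makes `(log x + 3 / 2) / x` a telescoping majorant. At `m = 0` the left side is `2 log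
      -- 2 < 3 / 2`; for `m ≥ 1` it is at most `(m + 2) / (m + 1) ≤ 3 / 2`.
      have h : ((m : ℝ) + 2) * (Real.log ((m : ℝ) + 2) - Real.log ((m : ℝ) + 1)) ≤ 3 / 2 := by
        rcases Nat.eq_zero_or_pos m with rfl | hm
        · have := Real.log_two_lt_d9
          norm_num
          linarith
        · have hm' : (1 : ℝ) ≤ m := by exact_mod_cast hm
          rw [← Real.log_div (by positivity) (by positivity)]
          have h1 := Real.log_le_sub_one_of_pos (x := ((m : ℝ) + 2) / (m + 1)) (by positivity)
          have h2 : ((m : ℝ) + 2) / (m + 1) - 1 = 1 / (m + 1) := by field_simp; ring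
          rw [h2] at h1
          calc _ ≤ ((m : ℝ) + 2) * (1 / (m + 1)) := by gcongr
            _ ≤ 3 / 2 := by
              rw [mul_one_div, div_le_div_iff₀ (by positivity) (by positivity)]
              linarith
      have e : (Real.log ((m : ℝ) + 1) + 3 / 2) / (m + 1) -
          (Real.log ((m : ℝ) + 2) + 3 / 2) / (m + 2) = (Real.log ((m : ℝ) + 2) + 3 / 2 -
            ((m : ℝ) + 2) * (Real.log ((m : ℝ) + 2) - Real.log ((m : ℝ) + 1))) /
            (((m : ℝ) + 2) * (m + 1)) := by
        field_simp
        ring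
      rw [e]
      gcongr
      linarith
    push_cast at ih ⊢
    have e1 : (m : ℝ) + 1 + 1 = m + 2 := by ring
    have e2 : (m : ℝ) + 2 - 1 = m + 1 := by ring
    rw [e1, e2]
    linarith

theorem sum_primeFactors_log_le {r : ℕ} (hr : r ≠ 0) :
    ∑ p ∈ r.primeFactors, Real.log p ≤ Real.log r := by
  rw [← Real.log_prod]
  · refine Real.log_le_log ?_ ?_
    · exact Finset.prod_pos fun p hp => by
        exact_mod_cast (Nat.prime_of_mem_primeFactors hp).pos
    · rw [← Nat.cast_prod]
      exact_mod_cast Nat.le_of_dvd (Nat.pos_of_ne_zero hr) (Nat.prod_primeFactors_dvd r)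
  · intro p hp
    exact_mod_cast (Nat.prime_of_mem_primeFactors hp).ne_zero

/-- Replacing `p - 1` by `p` costs at most `3 / 2`. Primes up to `y` fall under Mertens; for those
beyond, `1 / p ≤ 1 / y` and the logarithms sum to at most `log r`. -/
theorem sum_primeFactors_log_div_pred_le {r y : ℕ} (hr : r ≠ 0) (hy : 1 ≤ y) :
    ∑ p ∈ r.primeFactors, Real.log p / ((p : ℝ) - 1) ≤
      Real.log y + 1 / 2 + Real.log 4 + (1 + Real.log y) / y + Real.log r / y := by
  have hy' : (1 : ℝ) ≤ y := by exact_mod_cast hy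
  have h1 : ∑ p ∈ r.primeFactors, Real.log p / ((p : ℝ) - 1) =
      ∑ p ∈ r.primeFactors, Real.log p / p +
      ∑ p ∈ r.primeFactors, Real.log p / ((p : ℝ) * (p - 1)) := by
    rw [← Finset.sum_add_distrib]
    refine Finset.sum_congr rfl fun p hp => ?_
    have : (2 : ℝ) ≤ p := by exact_mod_cast (Nat.prime_of_mem_primeFactors hp).two_le
    have : (p : ℝ) - 1 ≠ 0 := by linarith
    field_simp
    ring
  have h2 : ∑ p ∈ r.primeFactors, Real.log p / ((p : ℝ) * (p - 1)) ≤ 3 / 2 := by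
    have hsub : r.primeFactors ⊆ Finset.Icc 2 (r + 1) := fun p hp => by
      have := (Nat.prime_of_mem_primeFactors hp).two_le
      have := Nat.le_of_mem_primeFactors hp
      exact Finset.mem_Icc.2 ⟨by omega, by omega⟩
    refine (Finset.sum_le_sum_of_subset_of_nonneg hsub fun p hp _ => ?_).trans
      ((sum_log_div_mul_pred_le r).trans ?_)
    · have : (2 : ℝ) ≤ p := by exact_mod_cast (Finset.mem_Icc.1 hp).1
      exact div_nonneg (Real.log_natCast_nonneg p)
        (mul_nonneg (by linarith) (by linarith))
    · have : 0 ≤ Real.log ((r : ℝ) + 1) := Real.log_nonneg (by linarith [Nat.cast_nonneg (α := ℝ) r])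
      have : 0 ≤ (Real.log ((r : ℝ) + 1) + 3 / 2) / (r + 1) := by positivity
      linarith
  have h3 : ∑ p ∈ r.primeFactors, Real.log p / p ≤
      ∑ p ∈ y.primesLE, Real.log p / p + Real.log r / y := by
    rw [← Finset.sum_filter_add_sum_filter_not r.primeFactors (fun p => p ≤ y)]
    refine add_le_add ?_ ?_
    · refine Finset.sum_le_sum_of_subset_of_nonneg (fun p hp => ?_) fun p _ _ =>
        div_nonneg (Real.log_natCast_nonneg p) (Nat.cast_nonneg p)
      obtain ⟨hp1, hp2⟩ := Finset.mem_filter.1 hp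
      exact Nat.mem_primesLE.2 ⟨hp2, Nat.prime_of_mem_primeFactors hp1⟩
    · refine le_trans ?_ (div_le_div_of_nonneg_right (sum_primeFactors_log_le hr) (by linarith))
      rw [Finset.sum_div]
      refine le_trans (Finset.sum_le_sum fun p hp => ?_)
        (Finset.sum_le_sum_of_subset_of_nonneg (Finset.filter_subset _ _) fun p _ _ =>
          div_nonneg (Real.log_natCast_nonneg p) (by linarith))
      obtain ⟨-, hp2⟩ := Finset.mem_filter.1 hp
      have : (y : ℝ) ≤ p := by exact_mod_cast (not_le.1 hp2).le
      exact div_le_div_of_nonneg_left (Real.log_natCast_nonneg p) (by linarith) this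
  have h4 := sum_log_div_le hy
  linarith

theorem div_totient_le_of_log_large {r : ℕ} (h : 10000 ≤ Real.log r) :
    (r : ℝ) / (r.totient : ℝ) ≤ Real.exp 1 * (Real.log (Real.log r) + 4) := by
  have hr : r ≠ 0 := by
    rintro rfl
    norm_num at h
  set X := Real.log r with hX
  have hXp : 0 < X := by linarith
  have hL : 0 < Real.log X := Real.log_pos (by linarith)
  set y := ⌈X⌉₊ with hy
  have hXy : X ≤ y := Nat.le_ceil X
  have hyX : (y : ℝ) < X + 1 := Nat.ceil_lt_add_one hXp.le
  have hy1 : 1 ≤ y := by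
    have : (1 : ℝ) ≤ y := by linarith
    exact_mod_cast this
  have hyp : (0 : ℝ) < y := by linarith
  have hsum := sum_primeFactors_log_div_pred_le hr hy1
  have h1 : Real.log y ≤ Real.log X + 1 / 10000 := by
    have e : Real.log y = Real.log X + Real.log (y / X) := by
      rw [Real.log_div hyp.ne' hXp.ne']
      ring
    have h2 := Real.log_le_sub_one_of_pos (div_pos hyp hXp)
    have h3 : (y : ℝ) / X - 1 ≤ 1 / 10000 := by
      rw [sub_le_iff_le_add, div_le_iff₀ hXp]
      linarith
    linarith
  have h2 : (1 + Real.log y) / y ≤ 3 / 100 := by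
    have hs : Real.log y = 2 * Real.log √y := by
      rw [Real.log_sqrt hyp.le]
      ring
    have hs1 := Real.log_le_sub_one_of_pos (Real.sqrt_pos.2 hyp)
    have hs2 : (100 : ℝ) ≤ √y := Real.le_sqrt_of_sq_le (by linarith)
    have hs3 := Real.sq_sqrt hyp.le
    rw [div_le_iff₀ hyp]
    nlinarith
  have h3 : X / y ≤ 1 := by
    rw [div_le_one hyp]
    exact hXy
  have h4 : Real.log 4 ≤ 1.3863 := by
    have : Real.log 4 = 2 * Real.log 2 := by
      rw [show (4 : ℝ) = 2 ^ 2 by norm_num, Real.log_pow]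
      norm_num
    have := Real.log_two_lt_d9
    linarith
  -- `0.0001 + 0.5 + 1.3863 + 0.03 + 1 < 3`. With `ε` the reciprocal of this bound, the exponential
  -- factor is at most `e`.
  have h5 : ∑ p ∈ r.primeFactors, Real.log p / ((p : ℝ) - 1) ≤ Real.log X + 3 := by
    linarith
  rw [totient_inv_eq_prod hr]
  have hε : 0 < 1 / (Real.log X + 3) := by positivity
  refine (prod_div_pred_le hε fun p hp => Nat.prime_of_mem_primeFactors hp).trans ?_
  rw [one_div_one_div, mul_comm]
  have h6 : 1 / (Real.log X + 3) * ∑ p ∈ r.primeFactors, Real.log p / ((p : ℝ) - 1) ≤ 1 := by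
    rw [one_div_mul_eq_div, div_le_one (by positivity)]
    exact h5
  have e : 1 + (Real.log X + 3) = Real.log X + 4 := by ring
  rw [e]
  gcongr

/-! ### Assembling the ranges of `r`. -/

theorem div_le_log_of_pow_le {a b : ℕ} {x : ℝ} (hb : 0 < b) (hx : 0 < x)
    (h : (2.7182818286 : ℝ) ^ a ≤ x ^ b) : (a : ℝ) / b ≤ Real.log x := by
  rw [div_le_iff₀ (by exact_mod_cast hb), mul_comm, ← Real.log_pow,
    Real.le_log_iff_exp_le (by positivity)]
  refine le_trans ?_ h
  rw [← Real.exp_one_pow]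
  gcongr
  exact Real.exp_one_lt_d9.le

theorem le_log_of_three_pow_le {k r : ℕ} (h : 3 ^ k ≤ r) : (k : ℝ) ≤ Real.log r := by
  have h3 : (1 : ℝ) ≤ Real.log 3 := by
    rw [Real.le_log_iff_exp_le (by norm_num)]
    linarith [Real.exp_one_lt_d9]
  have h' : ((3 : ℝ)) ^ k ≤ r := by exact_mod_cast h
  have := Real.log_le_log (by positivity) h'
  rw [Real.log_pow] at this
  nlinarith [Nat.cast_nonneg (α := ℝ) k]

/-- An explicit lower bound for Euler's function. -/
theorem div_totient_le_mul_log_log {r N : ℕ} (hr : r ≠ 0) (hrN : r < N) (hN : 158 ≤ N) :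
    (r : ℝ) / (r.totient : ℝ) ≤ 3.92 * Real.log (Real.log N) := by
  have hr0 : (0 : ℝ) < r := by exact_mod_cast Nat.pos_of_ne_zero hr
  have hlog : Real.log r ≤ Real.log N := Real.log_le_log hr0 (by exact_mod_cast hrN.le)
  have hN' : (158 : ℝ) ≤ N := by exact_mod_cast hN
  have h5 : (5 : ℝ) ≤ Real.log N := by
    have := div_le_log_of_pow_le (a := 5) (b := 1) (x := N) one_pos (by linarith)
      (le_trans (by norm_num) (pow_le_pow_left₀ (by norm_num) hN' 1))
    simpa using this
  have key : ∀ {a b : ℕ} {c : ℝ}, 0 < b → 0 < c → c ≤ Real.log N →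
      (2.7182818286 : ℝ) ^ a ≤ c ^ b → (a : ℝ) / b ≤ Real.log (Real.log N) := by
    intro a b c hb hc hcN h
    exact (div_le_log_of_pow_le hb hc h).trans (Real.log_le_log hc hcN)
  -- Failure of each bound forces the next lower bound for `log log N`: `1.6`, `2.8`, `17 / 3`,
  -- `9.1`. These suffice: `3.92` times the first three exceeds `6.12`, `10.88`, `22`, and `e (9.1 +
  -- 4) < 3.92 · 9.1`.
  rcases div_totient_le_or_three_pow_seventeen_le hr with h | h
  · have := key (a := 8) (b := 5) (c := 5) (by norm_num) (by norm_num) h5 (by norm_num)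
    norm_num at this h ⊢
    linarith
  rcases div_totient_le_or_three_pow_le hr with h' | h'
  · have := key (a := 14) (b := 5) (c := 17) (by norm_num) (by norm_num)
      (by simpa using (le_log_of_three_pow_le h).trans hlog) (by norm_num)
    norm_num at this h' ⊢
    linarith
  rcases div_totient_le_or_three_pow_large_le hr with h'' | h''
  · have := key (a := 17) (b := 3) (c := 358) (by norm_num) (by norm_num)
      (by simpa using (le_log_of_three_pow_le h').trans hlog) (by norm_num)
    norm_num at this ⊢
    linarith
  · have h10 : (10500 : ℝ) ≤ Real.log r := by simpa using le_log_of_three_pow_le h''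
    have := key (a := 91) (b := 10) (c := 10500) (by norm_num) (by norm_num)
      (h10.trans hlog) (by norm_num)
    have h1 := div_totient_le_of_log_large (r := r) (by linarith)
    have h2 : Real.log (Real.log r) ≤ Real.log (Real.log N) :=
      Real.log_le_log (by linarith) hlog
    have h3 := Real.exp_one_lt_d9
    have h4 : Real.exp 1 * (Real.log (Real.log r) + 4) ≤
        2.7182818286 * (Real.log (Real.log N) + 4) := by
      have : 0 ≤ Real.log (Real.log r) := Real.log_nonneg (by linarith)
      gcongr
    norm_num at this h4 ⊢
    linarith

/-! ### Amplitudes and measurement probabilities. -/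

section Registers

variable {n L : ℕ}

theorem applyMatrix_apply
    (M : Matrix (Fin (2 ^ n) × Fin (2 ^ L)) (Fin (2 ^ n) × Fin (2 ^ L)) ℂ)
    (v : TwoRegisters n L) (u : Fin (2 ^ n) × Fin (2 ^ L)) :
    applyMatrix M v u = ∑ w, M u w * v w := rfl

theorem applyMatrix_kronecker_one_apply (A : Matrix (Fin (2 ^ n)) (Fin (2 ^ n)) ℂ)
    (v : TwoRegisters n L) (x : Fin (2 ^ n)) (y : Fin (2 ^ L)) :
    applyMatrix (A ⊗ₖ (1 : Matrix (Fin (2 ^ L)) (Fin (2 ^ L)) ℂ)) v (x, y) =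
      ∑ x', A x x' * v (x', y) := by
  rw [applyMatrix_apply, Fintype.sum_prod_type]
  simp [Matrix.kroneckerMap_apply, Matrix.one_apply]

theorem applyMatrix_one_kronecker_apply (B : Matrix (Fin (2 ^ L)) (Fin (2 ^ L)) ℂ)
    (v : TwoRegisters n L) (x : Fin (2 ^ n)) (y : Fin (2 ^ L)) :
    applyMatrix ((1 : Matrix (Fin (2 ^ n)) (Fin (2 ^ n)) ℂ) ⊗ₖ B) v (x, y) =
      ∑ y', B y y' * v (x, y') := by
  rw [applyMatrix_apply, Fintype.sum_prod_type_right]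
  simp [Matrix.kroneckerMap_apply, Matrix.one_apply]

theorem applyMatrix_measureSecond_apply (b : Fin (2 ^ L)) (v : TwoRegisters n L)
    (x : Fin (2 ^ n)) (y : Fin (2 ^ L)) :
    applyMatrix (measureSecond n b) v (x, y) = if y = b then v (x, b) else 0 := by
  rw [measureSecond, applyMatrix_one_kronecker_apply]
  by_cases h : y = b
  · subst h
    simp [Matrix.single_apply]
  · simp [Ne.symm h, h]

theorem applyMatrix_measureFirst_apply (c : Fin (2 ^ n)) (v : TwoRegisters n L)
    (x : Fin (2 ^ n)) (y : Fin (2 ^ L)) :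
    applyMatrix (measureFirst L c) v (x, y) = if x = c then v (c, y) else 0 := by
  rw [measureFirst, applyMatrix_kronecker_one_apply]
  by_cases h : x = c
  · subst h
    simp [Matrix.single_apply]
  · simp [Ne.symm h, h]

theorem outcomeProb_measureFirst (c : Fin (2 ^ n)) (v : TwoRegisters n L) :
    outcomeProb (measureFirst L c) v = ∑ y, ‖v (c, y)‖ ^ 2 := by
  rw [outcomeProb, EuclideanSpace.norm_sq_eq, Fintype.sum_prod_type]
  simp_rw [applyMatrix_measureFirst_apply]
  rw [Finset.sum_eq_single c]
  · simp
  · intro x _ hx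
    simp [hx]
  · simp

theorem outcomeProb_measureSecond (b : Fin (2 ^ L)) (v : TwoRegisters n L) :
    outcomeProb (measureSecond n b) v = ∑ x, ‖v (x, b)‖ ^ 2 := by
  rw [outcomeProb, EuclideanSpace.norm_sq_eq, Fintype.sum_prod_type_right]
  simp_rw [applyMatrix_measureSecond_apply]
  rw [Finset.sum_eq_single b]
  · simp
  · intro x _ hx
    simp [hx]
  · simp

end Registers

section Shor

variable {N : ℕ}

theorem walshHadamard_apply_zero (n : ℕ) (x : Fin (2 ^ n)) :
    walshHadamard n x 0 = (((1 / √2 : ℝ) ^ n : ℝ) : ℂ) := by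
  simp [walshHadamard, hadamard]

theorem preparedState_apply (f : ℤ → ZMod N) (n : ℕ) (x : Fin (2 ^ n))
    (y : Fin (2 ^ secondSize N)) :
    preparedState f n (x, y) =
      if (y : ℕ) = (f ((x : ℕ) : ℤ)).val then (((1 / √2 : ℝ) ^ n : ℝ) : ℂ) else 0 := by
  rw [preparedState, applyMatrix_apply, Fintype.sum_prod_type, Finset.sum_eq_single x]
  · rw [Finset.sum_eq_single 0]
    · rw [applyMatrix_kronecker_one_apply, Finset.sum_eq_single 0]
      · rw [walshHadamard_apply_zero]
        simp [evalGate, ket]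
      · intro x' _ hx'
        simp [ket, hx']
      · simp
    · intro y' _ hy'
      rw [applyMatrix_kronecker_one_apply, Finset.sum_eq_zero, mul_zero]
      intro x' _
      simp [ket, hy']
    · simp
  · intro x' _ hx'
    refine Finset.sum_eq_zero fun y' _ => ?_
    simp [evalGate, hx'.symm]
  · simp

/-- The arguments `x < q` at which the value of `f` is represented by `b`. -/
def fiber (f : ℤ → ZMod N) (q b : ℕ) : Finset ℕ :=
  (Finset.range q).filter fun x => b = (f (x : ℤ)).val

theorem sum_fin_ite_eq_sum_fiber {M : Type*} [AddCommMonoid M] (f : ℤ → ZMod N) (q b : ℕ)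
    (g : ℕ → M) :
    ∑ x : Fin q, (if b = (f ((x : ℕ) : ℤ)).val then g x else 0) = ∑ x ∈ fiber f q b, g x := by
  rw [fiber, Finset.sum_filter, Finset.sum_range]

theorem secondProb_eq (f : ℤ → ZMod N) (n : ℕ) (b : Fin (2 ^ secondSize N)) :
    secondProb f n b = (fiber f (2 ^ n) b).card / 2 ^ n := by
  have h : ∀ x : Fin (2 ^ n), ‖preparedState f n (x, b)‖ ^ 2 =
      if (b : ℕ) = (f ((x : ℕ) : ℤ)).val then (1 / 2 ^ n : ℝ) else 0 := by
    intro x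
    rw [preparedState_apply]
    split_ifs
    · rw [Complex.norm_real, Real.norm_eq_abs, sq_abs, ← pow_mul, mul_comm n 2, pow_mul, div_pow,
        Real.sq_sqrt (by norm_num)]
      simp
    · simp
  rw [secondProb, outcomeProb_measureSecond]
  simp_rw [h]
  rw [sum_fin_ite_eq_sum_fiber f (2 ^ n) b fun _ => (1 / 2 ^ n : ℝ)]
  simp [div_eq_mul_inv]

/-- After `b` is observed, every `x` in the fiber has amplitude one over the square root of its
cardinality; the Fourier transform supplies the other factor `1 / 2 ^ n`. -/
theorem outcomeProb_transformedState (f : ℤ → ZMod N) (n : ℕ) (b : Fin (2 ^ secondSize N))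
    (c : Fin (2 ^ n)) :
    outcomeProb (measureFirst (secondSize N) c) (transformedState f n b) =
      1 / (2 ^ n * ((fiber f (2 ^ n) b).card : ℝ)) *
        ‖∑ x ∈ fiber f (2 ^ n) b,
          Complex.exp (-(2 * Real.pi * Complex.I * (c : ℕ) * (x : ℕ) / (2 ^ n : ℕ)))‖ ^ 2 := by
  set a : ℝ := 1 / √((2 ^ n : ℕ) : ℝ) * (1 / √(secondProb f n b)) * (1 / √2) ^ n with ha
  have h : ∀ y, transformedState f n b (c, y) = if y = b then (a : ℂ) *
      ∑ x ∈ fiber f (2 ^ n) b,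
        Complex.exp (-(2 * Real.pi * Complex.I * (c : ℕ) * (x : ℕ) / (2 ^ n : ℕ))) else 0 := by
    intro y
    rw [transformedState, applyMatrix_kronecker_one_apply]
    simp only [postState, PiLp.smul_apply, applyMatrix_measureSecond_apply, preparedState_apply]
    split_ifs with hy
    · rw [← sum_fin_ite_eq_sum_fiber f (2 ^ n) b
        fun x => Complex.exp (-(2 * Real.pi * Complex.I * (c : ℕ) * (x : ℕ) / (2 ^ n : ℕ))),
        Finset.mul_sum]
      refine Finset.sum_congr rfl fun x _ => ?_
      split_ifs
      · rw [qftMatrix, Matrix.of_apply, ha, secondProb, smul_eq_mul]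
        push_cast
        ring
      · simp
    · simp
  rw [outcomeProb_measureFirst, Finset.sum_eq_single b]
  · rw [h b, if_pos rfl, norm_mul, mul_pow, Complex.norm_real, Real.norm_eq_abs, sq_abs]
    congr 1
    have hp : 0 ≤ secondProb f n b := sq_nonneg _
    rw [ha, mul_pow, mul_pow, div_pow, div_pow, Real.sq_sqrt (by positivity), Real.sq_sqrt hp,
      ← pow_mul, mul_comm n 2, pow_mul, div_pow, Real.sq_sqrt (by norm_num), secondProb_eq]
    have h2 : (2 : ℝ) ^ n ≠ 0 := by positivity
    push_cast
    simp only [one_pow, one_div_div, one_div_pow]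
    field_simp
  · intro y _ hy
    rw [h y, if_neg hy]
    simp
  · simp

end Shor

/-! ### The fiber as an arithmetic progression. -/

section

variable {N : ℕ}

theorem HasPeriod.apply_add_mul {S : Type*} {f : ℤ → S} {r : ℤ} (hf : HasPeriod f r) (x : ℤ)
    (j : ℕ) : f (x + j * r) = f x := by
  induction j with
  | zero => simp
  | succ j ih =>
    rw [← ih, hf.1 (x + j * r)]
    push_cast
    ring_nf

theorem exists_fiber_eq {f : ℤ → ZMod N} {r q b : ℕ} [NeZero N] (hr : 1 ≤ r)
    (hf : HasPeriod f (r : ℤ)) (hb : (fiber f q b).Nonempty) :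
    ∃ x₀ m : ℕ, x₀ < r ∧ 1 ≤ m ∧ x₀ + (m - 1) * r < q ∧ q ≤ x₀ + m * r ∧
      fiber f q b = (Finset.range m).image fun j => x₀ + j * r := by
  obtain ⟨x₁, hx₁⟩ := hb
  simp only [fiber, Finset.mem_filter, Finset.mem_range] at hx₁
  obtain ⟨hx₁q, hx₁b⟩ := hx₁
  have hx₀r : x₁ % r < r := Nat.mod_lt _ hr
  have hx₀ : x₁ % r ≤ x₁ := Nat.mod_le _ _
  have hval : f ((x₁ % r : ℕ) : ℤ) = f (x₁ : ℤ) := by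
    rw [← hf.apply_add_mul ((x₁ % r : ℕ) : ℤ) (x₁ / r)]
    congr 1
    have := Nat.mod_add_div x₁ r
    rw [mul_comm] at this
    exact_mod_cast this
  -- The quotient is the largest `j` with `x₀ + j r ≤ q - 1`; adding `1` counts `j = 0`.
  refine ⟨x₁ % r, (q - 1 - x₁ % r) / r + 1, hx₀r, Nat.le_add_left 1 _, ?_, ?_, ?_⟩
  · have := Nat.div_mul_le_self (q - 1 - x₁ % r) r
    rw [Nat.add_sub_cancel]
    omega
  · have := Nat.lt_div_mul_add hr (a := q - 1 - x₁ % r)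
    rw [Nat.add_mul, Nat.one_mul]
    omega
  · ext x
    simp only [fiber, Finset.mem_filter, Finset.mem_range, Finset.mem_image]
    constructor
    · rintro ⟨hxq, hxb⟩
      have h1 : f ((x₁ % r : ℕ) : ℤ) = f (((x₁ % r : ℕ) : ℤ) + (x - (x₁ % r : ℕ))) := by
        rw [hval, add_sub_cancel]
        exact ZMod.val_injective N (hx₁b.symm.trans hxb)
      obtain ⟨k, hk⟩ := hf.2 _ _ h1
      have hk0 : 0 ≤ k := by
        by_contra hneg
        have h2 : (r : ℤ) * k ≤ r * (-1) :=
          mul_le_mul_of_nonneg_left (by omega) (Int.natCast_nonneg r)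
        omega
      lift k to ℕ using hk0
      have hx : x = x₁ % r + k * r := by
        have : (x : ℤ) = (x₁ % r : ℕ) + k * r := by linarith
        exact_mod_cast this
      refine ⟨k, ?_, hx.symm⟩
      rw [Nat.lt_succ_iff, Nat.le_div_iff_mul_le hr]
      omega
    · rintro ⟨j, hj, rfl⟩
      rw [Nat.lt_succ_iff, Nat.le_div_iff_mul_le hr] at hj
      refine ⟨by omega, ?_⟩
      push_cast
      have := hf.apply_add_mul ((x₁ % r : ℕ) : ℤ) j
      push_cast at this hval
      rw [this, hval, hx₁b]

end

/-! ### Lower bounds for the geometric sum. -/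

/-- Past `π / 2`, reflect and apply Jordan's inequality to `π - t`; the factor is the value of `(π -
t) / t` at the right endpoint. The extension is needed because `m r` may exceed `q`. -/
theorem two_div_pi_mul_le_sin {η t : ℝ} (hη0 : 0 ≤ η) (hη : η ≤ 1) (ht0 : 0 ≤ t)
    (ht : t ≤ Real.pi / 2 * (1 + η)) :
    2 / Real.pi * t * ((1 - η) / (1 + η)) ≤ Real.sin t := by
  have hpi := Real.pi_pos
  have hk0 : 0 ≤ (1 - η) / (1 + η) := div_nonneg (by linarith) (by linarith)
  have hk1 : (1 - η) / (1 + η) ≤ 1 := by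
    rw [div_le_one (by linarith)]
    linarith
  rcases le_total t (Real.pi / 2) with h | h
  · refine le_trans ?_ (Real.mul_le_sin ht0 h)
    exact mul_le_of_le_one_right (by positivity) hk1
  · rw [← Real.sin_pi_sub]
    refine le_trans ?_ (Real.mul_le_sin (x := Real.pi - t) ?_ (by linarith))
    · rw [mul_assoc]
      refine mul_le_mul_of_nonneg_left ?_ (by positivity)
      rw [mul_div_assoc', div_le_iff₀ (by linarith)]
      nlinarith
    · nlinarith

/-- The sum `S` satisfies `|sin t| |S| = |sin (m t)|`; use `|sin t| ≤ |t|` below and the extended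
Jordan inequality above. -/
theorem le_norm_sum_exp_pow {η t : ℝ} {m : ℕ} (hη0 : 0 ≤ η) (hη : η ≤ 1)
    (ht : m * |t| ≤ Real.pi / 2 * (1 + η)) :
    m * (2 / Real.pi) * ((1 - η) / (1 + η)) ≤
      ‖∑ j ∈ Finset.range m, Complex.exp (Complex.I * ((2 * t : ℝ) : ℂ)) ^ j‖ := by
  have hpi := Real.pi_pos
  have hm : (0 : ℝ) ≤ m := Nat.cast_nonneg m
  have hk0 : 0 ≤ (1 - η) / (1 + η) := div_nonneg (by linarith) (by linarith)
  have hk1 : (1 - η) / (1 + η) ≤ 1 := by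
    rw [div_le_one (by linarith)]
    linarith
  rcases eq_or_ne t 0 with rfl | h0
  · have h2 : 2 / Real.pi ≤ 1 := by
      rw [div_le_one hpi]
      linarith [Real.pi_gt_three]
    simp only [mul_zero, Complex.ofReal_zero, Complex.exp_zero, one_pow, Finset.sum_const,
      Finset.card_range, nsmul_eq_mul, mul_one, Complex.norm_natCast]
    calc (m : ℝ) * (2 / Real.pi) * ((1 - η) / (1 + η)) ≤ m * (2 / Real.pi) :=
          mul_le_of_le_one_right (by positivity) hk1
      _ ≤ m := mul_le_of_le_one_right hm h2
  · have hgeom := mul_geom_sum (Complex.exp (Complex.I * ((2 * t : ℝ) : ℂ))) m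
    have hpow : Complex.exp (Complex.I * ((2 * t : ℝ) : ℂ)) ^ m =
        Complex.exp (Complex.I * ((2 * (m * t) : ℝ) : ℂ)) := by
      rw [← Complex.exp_nat_mul]
      congr 1
      push_cast
      ring
    have hnorm := congrArg norm hgeom
    rw [norm_mul, hpow, Complex.norm_exp_I_mul_ofReal_sub_one,
      Complex.norm_exp_I_mul_ofReal_sub_one, mul_div_cancel_left₀ _ two_ne_zero,
      mul_div_cancel_left₀ _ two_ne_zero, norm_mul, norm_mul, Real.norm_eq_abs, Real.norm_eq_abs,
      Real.norm_eq_abs] at hnorm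
    have h1 : |Real.sin t| ≤ |t| := Real.abs_sin_le_abs
    have h2 : 2 / Real.pi * (m * |t|) * ((1 - η) / (1 + η)) ≤ |Real.sin (m * t)| := by
      refine (two_div_pi_mul_le_sin hη0 hη (by positivity) ht).trans ?_
      rcases abs_cases t with ⟨e, -⟩ | ⟨e, -⟩
      · rw [e]
        exact le_abs_self _
      · rw [e, mul_neg, Real.sin_neg]
        exact neg_le_abs _
    have h3 : 0 < |t| := abs_pos.2 h0
    set s := ‖∑ j ∈ Finset.range m, Complex.exp (Complex.I * ((2 * t : ℝ) : ℂ)) ^ j‖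
    have hs : 0 ≤ s := norm_nonneg _
    have h4 : |(2 : ℝ)| = 2 := abs_two
    rw [h4] at hnorm
    have h5 : |Real.sin t| * s ≤ |t| * s := mul_le_mul_of_nonneg_right h1 hs
    refine le_of_mul_le_mul_left ?_ h3
    calc |t| * (m * (2 / Real.pi) * ((1 - η) / (1 + η))) =
          2 / Real.pi * (m * |t|) * ((1 - η) / (1 + η)) := by ring
      _ ≤ |t| * s := by linarith

theorem norm_sum_fiber_eq {r q m x₀ s c : ℕ} (hr : 1 ≤ r) (hq : 0 < q) :
    ‖∑ x ∈ (Finset.range m).image (fun j => x₀ + j * r),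
        Complex.exp (-(2 * Real.pi * Complex.I * c * (x : ℕ) / q))‖ =
      ‖∑ j ∈ Finset.range m, Complex.exp (Complex.I *
        ((2 * (-(Real.pi * ((c : ℝ) * r - s * q) / q)) : ℝ) : ℂ)) ^ j‖ := by
  have hq' : (q : ℂ) ≠ 0 := by exact_mod_cast hq.ne'
  rw [Finset.sum_image]
  · have h : ∀ j ∈ Finset.range m,
        Complex.exp (-(2 * Real.pi * Complex.I * c * ((x₀ + j * r : ℕ) : ℂ) / q)) =
        Complex.exp (((-(2 * Real.pi * c * x₀ / q) : ℝ) : ℂ) * Complex.I) *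
          Complex.exp (Complex.I *
            ((2 * (-(Real.pi * ((c : ℝ) * r - s * q) / q)) : ℝ) : ℂ)) ^ j := by
      intro j _
      rw [← Complex.exp_nat_mul, ← Complex.exp_add, Complex.exp_eq_exp_iff_exists_int]
      -- Replacing `c r` by `c r - s q` changes the `j`-th phase by `j s` full turns.
      refine ⟨-(j * s : ℕ), ?_⟩
      push_cast
      field_simp
      ring
    rw [Finset.sum_congr rfl h, ← Finset.mul_sum, norm_mul, Complex.norm_exp_ofReal_mul_I, one_mul]
  · intro i _ j _ hij
    exact Nat.eq_of_mul_eq_mul_right hr (Nat.add_left_cancel hij)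

/-! ### Good outcomes, one for each `s`. -/

/-- The integer nearest to `s q / r`. -/
def nearest (q r s : ℕ) : ℕ := (2 * s * q + r - 1) / (2 * r)

theorem nearest_bounds {q r : ℕ} (hr : 1 ≤ r) (s : ℕ) :
    2 * s * q ≤ 2 * r * nearest q r s + r ∧ 2 * r * nearest q r s < 2 * s * q + r := by
  have h1 := Nat.div_mul_le_self (2 * s * q + r - 1) (2 * r)
  have h2 := Nat.lt_div_mul_add (a := 2 * s * q + r - 1) (b := 2 * r) (by omega)
  rw [mul_comm _ (2 * r)] at h1 h2
  unfold nearest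
  constructor <;> omega

theorem isNearestTo_nearest {q r : ℕ} (hr : 1 ≤ r) (s : ℕ) :
    IsNearestTo q r s (nearest q r s) := by
  obtain ⟨h1, h2⟩ := nearest_bounds (q := q) hr s
  have h1' : 2 * (s : ℝ) * q ≤ 2 * r * nearest q r s + r := by exact_mod_cast h1
  have h2' : 2 * (r : ℝ) * nearest q r s < 2 * s * q + r := by exact_mod_cast h2
  constructor <;> linarith

theorem nearest_lt {q r s : ℕ} (hr : 1 ≤ r) (hrq : r < q) (hs : s < r) : nearest q r s < q := by
  obtain ⟨-, h2⟩ := nearest_bounds (q := q) hr s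
  by_contra hc
  have h3 : 2 * r * q ≤ 2 * r * nearest q r s := Nat.mul_le_mul_left _ (not_lt.1 hc)
  have h4 : (s + 1) * q ≤ r * q := Nat.mul_le_mul_right _ hs
  nlinarith

/-- Distinct multiples `s q` are at least `q > r` apart, while the window around each has width `r`.
-/
theorem nearest_injective {q r : ℕ} (hr : 1 ≤ r) (hrq : r < q) :
    Function.Injective (nearest q r) := by
  have key : ∀ s t, s < t → nearest q r s ≠ nearest q r t := by
    intro s t hst he
    have h1 := (nearest_bounds (q := q) hr s).1
    have h2 := (nearest_bounds (q := q) hr s).2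
    have h3 := (nearest_bounds (q := q) hr t).1
    rw [he] at h2
    have h4 : (s + 1) * q ≤ t * q := Nat.mul_le_mul_right _ hst
    nlinarith
  intro s t he
  by_contra hne
  rcases lt_or_gt_of_ne hne with h | h
  · exact key s t h he
  · exact key t s h he.symm

theorem isGood_nearest {q r s : ℕ} (hr : 1 ≤ r) (hrq : r ^ 2 < q) (hs : s < r)
    (hsr : Nat.gcd s r = 1) : IsGood q r (nearest q r s) := by
  obtain ⟨h1, h2⟩ := isNearestTo_nearest (q := q) hr s
  refine ⟨s, hs, hsr, ⟨h1, h2⟩, ?_⟩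
  have hr' : (0 : ℝ) < r := by exact_mod_cast hr
  have hrq' : (r : ℝ) ^ 2 < q := by exact_mod_cast hrq
  have hq' : (0 : ℝ) < q := lt_of_le_of_lt (by positivity) hrq'
  have e : (nearest q r s : ℝ) / q - s / r = ((nearest q r s : ℝ) * r - s * q) / (q * r) := by
    field_simp
  rw [e, abs_div, abs_of_pos (mul_pos hq' hr')]
  calc |(nearest q r s : ℝ) * r - s * q| / (q * r) ≤ (r / 2) / (q * r) := by
        gcongr
        exact abs_le.2 ⟨by linarith, h2.le⟩
    -- Since `r² < q`, the approximation condition holds automatically.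
    _ = 1 / (2 * q) := by field_simp
    _ < 1 / (2 * (r : ℝ) ^ 2) := by gcongr

/-- The good outcomes coming from distinct `s` coprime to `r` are distinct. -/
theorem totient_mul_le_goodProb {N n r : ℕ} {f : ℤ → ZMod N} {b : Fin (2 ^ secondSize N)}
    (hr : 1 ≤ r) (hrq : r ^ 2 < 2 ^ n) {P : ℝ}
    (hP : ∀ c : Fin (2 ^ n), ∀ s : ℕ, IsNearestTo (2 ^ n) r s c →
      P ≤ outcomeProb (measureFirst (secondSize N) c) (transformedState f n b)) :
    r.totient * P ≤ goodProb f n r b := by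
  classical
  have hrq1 : r < 2 ^ n := lt_of_le_of_lt (Nat.le_self_pow two_ne_zero r) hrq
  set T := (Finset.range r).filter fun s => r.Coprime s with hT
  have hmem : ∀ {s}, s ∈ T → s < r ∧ Nat.gcd s r = 1 := by
    intro s hs
    obtain ⟨h1, h2⟩ := Finset.mem_filter.1 hs
    exact ⟨Finset.mem_range.1 h1, h2.symm⟩
  let φ : ℕ → Fin (2 ^ n) := fun s => Fin.ofNat (2 ^ n) (nearest (2 ^ n) r s)
  have hφ : ∀ {s}, s ∈ T → (φ s : ℕ) = nearest (2 ^ n) r s := fun hs =>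
    Nat.mod_eq_of_lt (nearest_lt hr hrq1 (hmem hs).1)
  have hinj : Set.InjOn φ T := by
    intro s hs t ht he
    have := congrArg Fin.val he
    rw [hφ hs, hφ ht] at this
    exact nearest_injective hr hrq1 this
  calc (r.totient : ℝ) * P = ∑ s ∈ T, P := by
        rw [Finset.sum_const, nsmul_eq_mul]
        rfl
    _ ≤ ∑ s ∈ T, outcomeProb (measureFirst (secondSize N) (φ s)) (transformedState f n b) := by
        refine Finset.sum_le_sum fun s hs => hP _ s ?_
        rw [hφ hs]
        exact isNearestTo_nearest hr s
    _ = ∑ c ∈ T.image φ, outcomeProb (measureFirst (secondSize N) c) (transformedState f n b) := by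
        rw [Finset.sum_image hinj]
    _ ≤ goodProb f n r b := by
        unfold goodProb
        refine Finset.sum_le_sum_of_subset_of_nonneg ?_ fun c _ _ => sq_nonneg _
        intro c hc
        obtain ⟨s, hs, rfl⟩ := Finset.mem_image.1 hc
        refine Finset.mem_filter.2 ⟨Finset.mem_univ _, ?_⟩
        rw [hφ hs]
        exact isGood_nearest hr hrq (hmem hs).1 (hmem hs).2

/-- A lower bound for the probability of the outcome nearest to `s q / r`; here `m` is the number
of arguments `x < q` with `f x = b`. -/
theorem exists_le_outcomeProb {N n r : ℕ} [NeZero N] {f : ℤ → ZMod N}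
    {b : Fin (2 ^ secondSize N)} (hr : 1 ≤ r) (hf : HasPeriod f (r : ℤ))
    (hb : 0 < secondProb f n b) :
    ∃ m : ℕ, (m - 1) * r < 2 ^ n ∧ 2 ^ n < (m + 1) * r ∧ (r = 1 → 2 ^ n ≤ m) ∧ 1 ≤ m ∧
      ∀ η : ℝ, 0 ≤ η → η ≤ 1 → (m : ℝ) * r ≤ 2 ^ n * (1 + η) →
      ∀ c : Fin (2 ^ n), ∀ s : ℕ, IsNearestTo (2 ^ n) r s c →
        4 / Real.pi ^ 2 * (m / 2 ^ n) * ((1 - η) / (1 + η)) ^ 2 ≤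
          outcomeProb (measureFirst (secondSize N) c) (transformedState f n b) := by
  have hne : (fiber f (2 ^ n) b).Nonempty := by
    rw [← Finset.card_pos]
    by_contra hc
    rw [secondProb_eq, Nat.eq_zero_of_not_pos hc] at hb
    simp at hb
  obtain ⟨x₀, m, hx₀, hm, h1, h2, hfib⟩ := exists_fiber_eq hr hf hne
  refine ⟨m, by omega, by rw [Nat.add_mul]; omega, ?_, hm, ?_⟩
  · rintro rfl
    omega
  intro η hη0 hη hmr c s hc
  have hq : (0 : ℝ) < 2 ^ n := by positivity
  have hm' : (0 : ℝ) < m := by exact_mod_cast hm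
  have hpi := Real.pi_pos
  have hcard : (fiber f (2 ^ n) b).card = m := by
    rw [hfib, Finset.card_image_of_injective, Finset.card_range]
    intro i j hij
    exact Nat.eq_of_mul_eq_mul_right hr (Nat.add_left_cancel hij)
  rw [outcomeProb_transformedState, hcard, hfib, norm_sum_fiber_eq (s := s) hr (by positivity)]
  obtain ⟨hc1, hc2⟩ := hc
  have habs : |(c : ℝ) * r - s * ((2 ^ n : ℕ) : ℝ)| ≤ r / 2 := abs_le.2 ⟨by linarith, hc2.le⟩
  have ht : (m : ℝ) * |-(Real.pi * ((c : ℝ) * r - s * ((2 ^ n : ℕ) : ℝ)) / ((2 ^ n : ℕ) : ℝ))| ≤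
      Real.pi / 2 * (1 + η) := by
    rw [abs_neg, abs_div, abs_mul, abs_of_pos hpi, Nat.abs_cast, mul_div_assoc',
      div_le_iff₀ (by positivity)]
    push_cast at habs ⊢
    calc (m : ℝ) * (Real.pi * |(c : ℝ) * r - s * 2 ^ n|) ≤ m * (Real.pi * (r / 2)) := by gcongr
      _ = Real.pi / 2 * (m * r) := by ring
      _ ≤ Real.pi / 2 * (2 ^ n * (1 + η)) := by gcongr
      _ = _ := by ring
  have h := le_norm_sum_exp_pow hη0 hη ht
  have hk0 : 0 ≤ (1 - η) / (1 + η) := div_nonneg (by linarith) (by linarith)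
  calc 4 / Real.pi ^ 2 * (m / 2 ^ n) * ((1 - η) / (1 + η)) ^ 2 =
      1 / (2 ^ n * m) * (m * (2 / Real.pi) * ((1 - η) / (1 + η))) ^ 2 := by
        field_simp
        ring
    _ ≤ _ := by gcongr

/-- With `η = r / q`, one factor `1 - η` comes from `m / q ≥ (1 - η) / r`, the square of `(1 - η) /
(1 + η)` from the sine bound. -/
theorem totient_mul_le_goodProb_of_hasPeriod {N n r : ℕ} [NeZero N] {f : ℤ → ZMod N}
    {b : Fin (2 ^ secondSize N)} (hr : 1 ≤ r) (hrq : r ^ 2 < 2 ^ n) (hf : HasPeriod f (r : ℤ))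
    (hb : 0 < secondProb f n b) :
    4 / Real.pi ^ 2 * ((r.totient : ℝ) / r) *
      ((1 - r / 2 ^ n) ^ 3 / (1 + r / 2 ^ n) ^ 2) ≤ goodProb f n r b := by
  obtain ⟨m, h1, h2, -, hm, h⟩ := exists_le_outcomeProb hr hf hb
  have hq : (0 : ℝ) < 2 ^ n := by positivity
  have hr' : (0 : ℝ) < r := by exact_mod_cast hr
  have hrq1 : (r : ℝ) ≤ 2 ^ n := by
    exact_mod_cast (lt_of_le_of_lt (Nat.le_self_pow two_ne_zero r) hrq).le
  have hη1 : (r : ℝ) / 2 ^ n ≤ 1 := by rwa [div_le_one hq]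
  have hη0 : 0 ≤ (r : ℝ) / 2 ^ n := by positivity
  have h1' : ((m : ℝ) - 1) * r ≤ 2 ^ n := by
    have := h1.le
    rw [← Nat.cast_le (α := ℝ)] at this
    push_cast [Nat.cast_sub hm] at this
    exact this
  have h2' : (2 : ℝ) ^ n ≤ (m + 1) * r := by exact_mod_cast h2.le
  have h3 := totient_mul_le_goodProb hr hrq (h (r / 2 ^ n) hη0 hη1 (by
    rw [mul_add, mul_div_cancel₀ _ hq.ne']
    linarith))
  refine le_trans ?_ h3
  have h4 : (1 - r / 2 ^ n) / r ≤ (m : ℝ) / 2 ^ n := by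
    rw [div_le_div_iff₀ hr' hq, sub_mul, div_mul_cancel₀ _ hq.ne']
    linarith
  calc _ = (r.totient : ℝ) * (4 / Real.pi ^ 2 * ((1 - r / 2 ^ n) / r) *
        ((1 - r / 2 ^ n) / (1 + r / 2 ^ n)) ^ 2) := by
        rw [div_pow]
        ring
    _ ≤ _ := by gcongr

theorem le_one_sub_pow_div {η a : ℝ} (h0 : 0 ≤ η) (h : η ≤ a) (ha : a ≤ 1) :
    (1 - a) ^ 3 / (1 + a) ^ 2 ≤ (1 - η) ^ 3 / (1 + η) ^ 2 := by
  have : 0 ≤ 1 - a := by linarith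
  have : 0 ≤ 1 - η := by linarith
  gcongr

theorem four_mul_totient_div_le_goodProb {N n r : ℕ} (hr : 1 ≤ r) (hrN : r < N)
    (hqN : N ^ 2 ≤ 2 ^ n) {f : ℤ → ZMod N} (hf : HasPeriod f (r : ℤ))
    {b : Fin (2 ^ secondSize N)} (hb : 0 < secondProb f n b) :
    4 * (r.totient : ℝ) / (Real.pi ^ 2 * (r : ℝ) ^ 2) ≤ goodProb f n r b := by
  have : NeZero N := ⟨by omega⟩
  have hrq : r ^ 2 < 2 ^ n := (Nat.pow_lt_pow_left hrN two_ne_zero).trans_le hqN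
  have hq : (0 : ℝ) < 2 ^ n := by positivity
  have hr' : (0 : ℝ) < r := by exact_mod_cast hr
  have hpi := Real.pi_pos
  rcases hr.eq_or_lt with rfl | hr2
  -- For `r = 1` no loss is affordable, but `m = q` exactly, so `η = 0` is allowed.
  · obtain ⟨m, h1, -, h3, hm, h⟩ := exists_le_outcomeProb le_rfl hf hb
    have hqm : (2 : ℝ) ^ n ≤ m := by exact_mod_cast h3 rfl
    have hmq : (m : ℝ) ≤ 2 ^ n := by
      have : m ≤ 2 ^ n := by omega
      exact_mod_cast this
    have h4 := totient_mul_le_goodProb le_rfl hrq (h 0 le_rfl zero_le_one (by simpa using hmq))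
    refine le_trans (le_of_eq ?_) h4
    rw [le_antisymm hmq hqm, div_self hq.ne']
    simp
  · have hq0 : (0 : ℝ) ≤ r / 2 ^ n := by positivity
    have key : 1 / (r : ℝ) ≤ (1 - r / 2 ^ n) ^ 3 / (1 + r / 2 ^ n) ^ 2 := by
      rcases (show 2 ≤ r from hr2).eq_or_lt with rfl | hr3
      -- `q` is a power of two and at least `3²`, hence at least `16`.
      · have hn : 4 ≤ n := by
          by_contra hc
          have h1 : 2 ^ n ≤ 2 ^ 3 := Nat.pow_le_pow_right two_pos (by omega)
          have h2 : 3 ^ 2 ≤ N ^ 2 := Nat.pow_le_pow_left hrN 2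
          omega
        have h16 : (2 : ℝ) ^ 4 ≤ 2 ^ n := pow_le_pow_right₀ one_le_two hn
        have : ((2 : ℕ) : ℝ) / 2 ^ n ≤ 1 / 8 := by
          rw [div_le_div_iff₀ hq (by norm_num)]
          push_cast
          linarith
        refine le_trans ?_ (le_one_sub_pow_div hq0 this (by norm_num))
        norm_num
      · have hr3' : (3 : ℝ) ≤ r := by exact_mod_cast hr3
        have h1 : (r + 1) ^ 2 ≤ 2 ^ n := (Nat.pow_le_pow_left hrN 2).trans hqN
        have h1' : ((r : ℝ) + 1) ^ 2 ≤ 2 ^ n := by exact_mod_cast h1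
        -- From `(r + 1)² ≤ q`; the extreme value of `r / (r + 1)²` is at `r = 3`.
        have : (r : ℝ) / 2 ^ n ≤ 3 / 16 := by
          rw [div_le_div_iff₀ hq (by norm_num)]
          nlinarith
        refine le_trans ?_ (le_one_sub_pow_div hq0 this (by norm_num))
        calc 1 / (r : ℝ) ≤ 1 / 3 := by gcongr
          _ ≤ _ := by norm_num
    refine le_trans ?_ (totient_mul_le_goodProb_of_hasPeriod hr hrq hf hb)
    calc 4 * (r.totient : ℝ) / (Real.pi ^ 2 * (r : ℝ) ^ 2) =
        4 / Real.pi ^ 2 * ((r.totient : ℝ) / r) * (1 / r) := by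
          field_simp
      _ ≤ _ := by gcongr

theorem one_div_log_log_le_goodProb {N n r : ℕ} (hr : 1 ≤ r) (hrN : r < N)
    (hqN : N ^ 2 ≤ 2 ^ n) {f : ℤ → ZMod N} (hf : HasPeriod f (r : ℤ))
    {b : Fin (2 ^ secondSize N)} (hb : 0 < secondProb f n b) (hN : 158 ≤ N) :
    1 / (10 * Real.log (Real.log (N : ℝ))) ≤ goodProb f n r b := by
  have : NeZero N := ⟨by omega⟩
  have hrq : r ^ 2 < 2 ^ n := (Nat.pow_lt_pow_left hrN two_ne_zero).trans_le hqN
  have hq : (0 : ℝ) < 2 ^ n := by positivity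
  have hr' : (0 : ℝ) < r := by exact_mod_cast hr
  have hφ : (0 : ℝ) < r.totient := by exact_mod_cast Nat.totient_pos.2 hr
  have hpi := Real.pi_pos
  have htot := div_totient_le_mul_log_log (by omega) hrN hN
  have hll : 0 < Real.log (Real.log (N : ℝ)) := by
    have : 0 < (r : ℝ) / r.totient := by positivity
    linarith
  have hη : (r : ℝ) / 2 ^ n ≤ 1 / 158 := by
    rw [div_le_div_iff₀ hq (by norm_num), one_mul]
    have : r * 158 ≤ 2 ^ n := (Nat.mul_le_mul hrN.le hN).trans (by rwa [← sq])
    exact_mod_cast this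
  have h1 : (0.968 : ℝ) ≤ (1 - r / 2 ^ n) ^ 3 / (1 + r / 2 ^ n) ^ 2 :=
    le_trans (by norm_num) (le_one_sub_pow_div (by positivity) hη (by norm_num))
  have h2 : (0.4052 : ℝ) ≤ 4 / Real.pi ^ 2 := by
    rw [le_div_iff₀ (by positivity)]
    nlinarith [Real.pi_lt_d4]
  have h3 : 1 / (3.92 * Real.log (Real.log N)) ≤ (r.totient : ℝ) / r := by
    rw [← one_div_div (r : ℝ)]
    exact one_div_le_one_div_of_le (by positivity) htot
  calc 1 / (10 * Real.log (Real.log (N : ℝ))) ≤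
      0.4052 * (1 / (3.92 * Real.log (Real.log N))) * 0.968 := by
        have e : 0.4052 * (1 / (3.92 * Real.log (Real.log N))) * 0.968 =
          0.4052 * 0.968 / 3.92 * (1 / Real.log (Real.log (N : ℝ))) := by field_simp
        rw [e, show 1 / (10 * Real.log (Real.log (N : ℝ))) =
          1 / 10 * (1 / Real.log (Real.log (N : ℝ))) by field_simp]
        -- Tight: `0.4052 · 0.968 / 3.92` barely exceeds `1 / 10`, which dictates the constant
        -- `3.92`.
        exact mul_le_mul_of_nonneg_right (by norm_num) (by positivity)
    _ ≤ 4 / Real.pi ^ 2 * ((r.totient : ℝ) / r) *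
        ((1 - r / 2 ^ n) ^ 3 / (1 + r / 2 ^ n) ^ 2) := by gcongr
    _ ≤ _ := totient_mul_le_goodProb_of_hasPeriod hr hrq hf hb

theorem mainTheorem1 (N n q r : ℕ) (hr : 1 ≤ r) (hrN : r < N)
    (hq : q = 2 ^ n) (hqN : N ^ 2 ≤ q) (hqN' : q < 2 * N ^ 2)
    (f : ℤ → ZMod N) (hf : HasPeriod f (r : ℤ))
    (b : Fin (2 ^ secondSize N)) (hb : 0 < secondProb f n b) :
    4 * (Nat.totient r : ℝ) / (Real.pi ^ 2 * (r : ℝ) ^ 2) *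
        (1 - (Real.pi * (r : ℝ) / (2 * (q : ℝ))) ^ 2) ≤ goodProb f n r b ∧
      (158 ≤ N → 19 ≤ r →
        1 / (10 * Real.log (Real.log (N : ℝ))) ≤ goodProb f n r b) := by
  subst hq
  refine ⟨?_, fun hN _ => one_div_log_log_le_goodProb hr hrN hqN hf hb hN⟩
  refine le_trans ?_ (four_mul_totient_div_le_goodProb hr hrN hqN hf hb)
  exact mul_le_of_le_one_right (by positivity) (sub_le_self _ (sq_nonneg _))
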